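/- For $n\ge 1$ and $c\in\{0,1\}^n$ let $f_c:\mathbb{R}^n\to\mathbb{R}$, $$f_c(x)=\max_{1\le i\le n}|\pi(x_i)-c_i|+\sum_{i=1}^n|\pi(x_i)-x_i|,$$ where $\pi:\mathbb{R}\to[0,1]$ is $\pi(t)=0$ for $t<0$, $\pi(t)=t$ for $0\le t\le 1$ and $\pi(t)=1$ for $t>1$. Then: (i) $f_c$ is convex on $\mathbb{R}^n$ and $x=c$ is its unique minimizer over $\mathbb{R}^n$. (ii) There is an absolute constant $C>0$ such that the following holds for every $n\ge 2$. Consider any quantum algorithm that has access to an unknown $f_c$ only through the exact evaluation oracle, that is, the unitary $O_{f_c}$ with $O_{f_c}|x\rangle|z\rangle=|x\rangle|z+f_c(x)\rangle$ for all $x\in\mathbb{R}^n$, $z\in\mathbb{R}$ (so that $O_{f_c}|x\rangle|0\rangle=|x\rangle|f_c(x)\rangle$), or its inverse: it starts in a fixed state, alternates oracle queries with arbitrary fixed unitaries on the query register, the answer register and an arbitrary workspace, and finally measures in the computational basis and computes its output $\tilde x$ from the outcome. If for every $c\in\{0,1\}^n$ it outputs, with probability at least $0.9$, a point $\tilde x\in[0,1]^n$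 such that $$f_c(\tilde x)\le\min_{x\in[0,1]^n}f_c(x)+\tfrac13,$$ then it makes at least $C\sqrt n/\log n$ queries. The same bound holds for the unconstrained problem, in which $[0,1]^n$ is replaced by $\mathbb{R}^n$ in both places. -/

import Mathlib

open scoped lp

namespace MaxNormOpt

noncomputable section

universe u

/-! ### The max-norm optimization problem -/

/-- The projection `π` of the real line onto `[0,1]`. -/
def proj (t : ℝ) : ℝ := if t < 0 then 0 else if t ≤ 1 then t else 1

/-- The bit string `c ∈ {0,1}ⁿ`, seen as a point of `ℝⁿ`. -/
def point {n : ℕ} (c : Fin n → Bool) : Fin n → ℝ := fun i => if c i then 1 else 0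

/-- The objective `f_c(x) = max_i |π(x_i) - c_i| + ∑_i |π(x_i) - x_i|` on all of `ℝⁿ`.
(The supremum is over a finite index set, so it is a maximum as soon as `0 < n`.) -/
def objective {n : ℕ} (c : Fin n → Bool) (x : Fin n → ℝ) : ℝ :=
  (⨆ i, |proj (x i) - point c i|) + ∑ i, |proj (x i) - x i|

/-- The unit cube `[0,1]ⁿ`. -/
def unitCube (n : ℕ) : Set (Fin n → ℝ) := {x | ∀ i, 0 ≤ x i ∧ x i ≤ 1}

/-- `ε`-approximate minimizers of `f` over `K`: the points `x̃ ∈ K` whose value is within `ε` of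
the value at every point of `K`. -/
def approxMin {n : ℕ} (f : (Fin n → ℝ) → ℝ) (K : Set (Fin n → ℝ)) (ε : ℝ) : Set (Fin n → ℝ) :=
  {x | x ∈ K ∧ ∀ y ∈ K, f x ≤ f y + ε}

/-! ### Quantum query algorithms with an exact evaluation oracle -/

/-- Labels of the computational basis kets `|x, z, w⟩`: a query register `x ∈ ℝⁿ`, an answer
register `z ∈ ℝ`, and a workspace with label set `W`. -/
abbrev Label (n : ℕ) (W : Type u) : Type u := (Fin n → ℝ) × ℝ × W

/-- The Hilbert space with orthonormal basis the kets `|x, z, w⟩`. -/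
abbrev State (n : ℕ) (W : Type u) : Type u := ℓ²(Label n W, ℂ)

/-- The basis ket with a given label. -/
def ket {ι : Type u} (b : ι) : ℓ²(ι, ℂ) :=
  letI := Classical.decEq ι
  lp.single 2 b 1

/-- Relabelling the basis by a permutation keeps square-summability. -/
theorem memlp_comp_equiv {ι : Type u} (e : ι ≃ ι) (ψ : ℓ²(ι, ℂ)) :
    Memℓp (fun b => ψ (e.symm b)) 2 := by
  have h : Memℓp (fun b => ψ b) 2 := lp.memℓp ψ
  rw [memℓp_gen_iff (by norm_num)] at h ⊢
  exact (Equiv.summable_iff e.symm).mpr h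

/-- The unitary that permutes the basis kets: `|b⟩ ↦ |e b⟩`. -/
def permUnitary {ι : Type u} (e : ι ≃ ι) : ℓ²(ι, ℂ) ≃ₗᵢ[ℂ] ℓ²(ι, ℂ) where
  toFun ψ := ⟨fun b => ψ (e.symm b), memlp_comp_equiv e ψ⟩
  invFun ψ := ⟨fun b => ψ (e b), memlp_comp_equiv e.symm ψ⟩
  left_inv ψ := by ext b; simp
  right_inv ψ := by ext b; simp
  map_add' _ _ := rfl
  map_smul' _ _ := rfl
  norm_map' ψ := by
    rw [lp.norm_eq_tsum_rpow (by norm_num), lp.norm_eq_tsum_rpow (by norm_num)]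
    congr 1
    exact Equiv.tsum_eq e.symm (fun b => ‖ψ b‖ ^ (2 : ENNReal).toReal)

theorem permUnitary_ket {ι : Type u} (e : ι ≃ ι) (b : ι) :
    permUnitary e (ket b) = ket (e b) := by
  classical
  ext a
  change ket b (e.symm a) = ket (e b) a
  simp [ket, Pi.single_apply, Equiv.symm_apply_eq]

/-- Adding the value `f x` to the answer register. -/
def answerShift {n : ℕ} (f : (Fin n → ℝ) → ℝ) (W : Type u) : Label n W ≃ Label n W where
  toFun b := (b.1, b.2.1 + f b.1, b.2.2)
  invFun b := (b.1, b.2.1 - f b.1, b.2.2)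
  left_inv b := by simp
  right_inv b := by simp

/-- The exact evaluation oracle `O_f |x, z, w⟩ = |x, z + f x, w⟩`. -/
def evalOracle {n : ℕ} (f : (Fin n → ℝ) → ℝ) (W : Type u) : State n W ≃ₗᵢ[ℂ] State n W :=
  permUnitary (answerShift f W)

/-- On a blank answer register the oracle acts as `O_f |x, 0⟩ = |x, f x⟩`. -/
theorem evalOracle_ket {n : ℕ} (f : (Fin n → ℝ) → ℝ) (W : Type u) (x : Fin n → ℝ) (w : W) :
    evalOracle f W (ket (x, 0, w)) = ket (x, f x, w) := by
  simp [evalOracle, permUnitary_ket, answerShift]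

/-- A quantum algorithm with oracle access to an unknown function on `ℝⁿ`: it starts in a fixed
unit vector, alternates fixed unitaries with `queries` many uses of the oracle (or of its inverse,
when `inverse t` holds for the `t`-th use), then measures in the computational basis and outputs a
point of `ℝⁿ` computed from the measured label. Nothing but the oracle depends on the unknown
function. -/
structure QueryAlgorithm (n : ℕ) (W : Type u) where
  queries : ℕ
  init : State n W
  norm_init : ‖init‖ = 1
  gate : ℕ → (State n W ≃ₗᵢ[ℂ] State n W)
  inverse : ℕ → Bool
  output : Label n W → (Fin n → ℝ)

namespace QueryAlgorithm

variable {n : ℕ} {W : Type u} (A : QueryAlgorithm n W) (f : (Fin n → ℝ) → ℝ)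

/-- The state after the first `t` queries when the oracle is `O_f`. -/
def stateAfter : ℕ → State n W
  | 0 => A.gate 0 A.init
  | t + 1 => A.gate (t + 1)
      (if A.inverse t then (evalOracle f W).symm (stateAfter t) else evalOracle f W (stateAfter t))

/-- The probability (Born rule) that the output lies in `S` when the oracle is `O_f`. -/
def outputProb (S : Set (Fin n → ℝ)) : ℝ :=
  ∑' b : {b : Label n W // A.output b ∈ S}, ‖A.stateAfter f A.queries b‖ ^ 2

/-- For every `c ∈ {0,1}ⁿ`, run with the oracle of `f_c`, the algorithm outputs with probability at
least `0.9` a point of `K` whose value is within `1/3` of the minimum of `f_c` over `K`. -/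
def SolvesMaxNorm (K : Set (Fin n → ℝ)) : Prop :=
  ∀ c : Fin n → Bool,
    (9 / 10 : ℝ) ≤ A.outputProb (objective c) (approxMin (objective c) K (1 / 3))

end QueryAlgorithm

end

end MaxNormOpt

namespace MaxNormOpt

noncomputable section

open scoped InnerProductSpace

universe v

/-! ### The objective function -/

/-! Convexity: `|proj t - a|` is not convex, but for a bit `a` adding the penalty `|proj t - t|`
gives `|t - a|`. So the objective is a maximum of convex functions, one for each index.

Lower bound: a weighted adversary argument over pairs of strings differing in one bit. At a query
point where index `k` attains the maximum, only flipping bit `k` can lower the value. Weighting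
falling flips by `√n` and rising ones by its inverse keeps the total weight at each string and point
at most `2 * √n` (`sum_weight_flipBit_le`), so one query moves the sum of the `2 ^ n * n` inner
products by at most `2 ^ n * (4 * √n)`. The sum must drop from `2 ^ n * n` to at most `3/5` of that,
because neighbouring strings have disjoint sets of acceptable outputs. This forces `√n / 10`
queries, with no logarithmic loss. -/

theorem proj_mem (t : ℝ) : 0 ≤ proj t ∧ proj t ≤ 1 := by
  unfold proj
  split_ifs <;> constructor <;> linarith

theorem convexOn_abs_sub (a : ℝ) : ConvexOn ℝ Set.univ fun t : ℝ => |t - a| := by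
  refine ⟨convex_univ, fun x _ y _ p q hp hq hpq => ?_⟩
  have h : p • x + q • y - a = p * (x - a) + q * (y - a) := by
    simp only [smul_eq_mul]; linear_combination a * hpq
  change |p • x + q • y - a| ≤ p * |x - a| + q * |y - a|
  rw [h]
  refine (abs_add_le _ _).trans ?_
  rw [abs_mul, abs_mul, abs_of_nonneg hp, abs_of_nonneg hq]

/-- Exhibits the distance to `[0,1]` as visibly convex. -/
theorem abs_proj_sub_self (t : ℝ) : |proj t - t| = (|t - 0| + |t - 1| - 1) / 2 := by
  unfold proj
  split_ifs with h₀ h₁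
  · rw [abs_of_pos (by linarith : 0 < 0 - t), abs_of_neg (by linarith : t - 0 < 0),
      abs_of_neg (by linarith : t - 1 < 0)]
    ring
  · rw [abs_of_nonneg (by linarith : 0 ≤ t - 0), abs_of_nonpos (by linarith : t - 1 ≤ 0)]
    simp
  · rw [abs_of_neg (by linarith : 1 - t < 0), abs_of_pos (by linarith : 0 < t - 0),
      abs_of_pos (by linarith : 0 < t - 1)]
    ring

theorem convexOn_abs_proj_sub_self : ConvexOn ℝ Set.univ fun t : ℝ => |proj t - t| := by
  have h := ((convexOn_abs_sub 0).add (convexOn_abs_sub 1)).smul (by norm_num : (0 : ℝ) ≤ 1 / 2)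
  refine (h.add_const (-1 / 2)).congr fun t _ => ?_
  simp only [abs_proj_sub_self, smul_eq_mul, Pi.add_apply]
  ring

/-- For a bit `a`, the projection error makes up for the truncation of the distance to `a`. -/
theorem abs_proj_sub_add (t : ℝ) {a : ℝ} (ha : a = 0 ∨ a = 1) :
    |proj t - a| + |proj t - t| = |t - a| := by
  rw [abs_proj_sub_self]
  obtain ⟨h₀, h₁⟩ := proj_mem t
  rcases ha with rfl | rfl
  · rw [abs_of_nonneg (by linarith : 0 ≤ proj t - 0)]
    unfold proj
    split_ifs with h h'
    · rw [abs_of_neg (by linarith : t - 0 < 0), abs_of_neg (by linarith : t - 1 < 0)]; ring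
    · rw [abs_of_nonneg (by linarith : 0 ≤ t - 0), abs_of_nonpos (by linarith : t - 1 ≤ 0)]; ring
    · rw [abs_of_pos (by linarith : 0 < t - 0), abs_of_pos (by linarith : 0 < t - 1)]; ring
  · rw [abs_of_nonpos (by linarith : proj t - 1 ≤ 0)]
    unfold proj
    split_ifs with h h'
    · rw [abs_of_neg (by linarith : t - 0 < 0), abs_of_neg (by linarith : t - 1 < 0)]; ring
    · rw [abs_of_nonneg (by linarith : 0 ≤ t - 0), abs_of_nonpos (by linarith : t - 1 ≤ 0)]; ring
    · rw [abs_of_pos (by linarith : 0 < t - 0), abs_of_pos (by linarith : 0 < t - 1)]; ring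

theorem point_eq_zero_or_one {n : ℕ} (c : Fin n → Bool) (i : Fin n) :
    point c i = 0 ∨ point c i = 1 := by
  unfold point
  split_ifs <;> simp

theorem proj_point {n : ℕ} (c : Fin n → Bool) (i : Fin n) : proj (point c i) = point c i := by
  rcases point_eq_zero_or_one c i with h | h <;> rw [h] <;> norm_num [proj]

theorem convexOn_apply {n : ℕ} (i : Fin n) {g : ℝ → ℝ} (hg : ConvexOn ℝ Set.univ g) :
    ConvexOn ℝ Set.univ fun x : Fin n → ℝ => g (x i) :=
  ⟨convex_univ, fun x _ y _ _ _ hp hq hpq =>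
    hg.2 (Set.mem_univ (x i)) (Set.mem_univ (y i)) hp hq hpq⟩

theorem abs_le_iSup {n : ℕ} (c : Fin n → Bool) (x : Fin n → ℝ) (i : Fin n) :
    |proj (x i) - point c i| ≤ ⨆ i, |proj (x i) - point c i| :=
  le_ciSup (f := fun i => |proj (x i) - point c i|) (Set.finite_range _).bddAbove i

theorem exists_objective_eq {n : ℕ} [Nonempty (Fin n)] (c : Fin n → Bool) (x : Fin n → ℝ) :
    ∃ i, objective c x = |proj (x i) - point c i| + ∑ j, |proj (x j) - x j| := by
  obtain ⟨i, hi⟩ := exists_eq_ciSup_of_finite (f := fun i => |proj (x i) - point c i|)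
  exact ⟨i, by rw [objective, ← hi]⟩

theorem le_objective {n : ℕ} (c : Fin n → Bool) (x : Fin n → ℝ) (i : Fin n) :
    |proj (x i) - point c i| + ∑ j, |proj (x j) - x j| ≤ objective c x :=
  add_le_add_left (abs_le_iSup c x i) _

theorem convexOn_abs_proj_sub_add_sum {n : ℕ} (c : Fin n → Bool) (i : Fin n) :
    ConvexOn ℝ Set.univ fun x : Fin n → ℝ =>
      |proj (x i) - point c i| + ∑ j, |proj (x j) - x j| := by
  have h₁ := convexOn_apply i (convexOn_abs_sub (point c i))
  have h₂ : ConvexOn ℝ Set.univ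
      fun x : Fin n → ℝ => ∑ j ∈ Finset.univ.erase i, |proj (x j) - x j| := by
    refine ⟨convex_univ, fun x _ y _ p q hp hq hpq => ?_⟩
    simp only [smul_eq_mul, Finset.mul_sum, ← Finset.sum_add_distrib]
    exact Finset.sum_le_sum fun j _ =>
      (convexOn_apply j convexOn_abs_proj_sub_self).2 (Set.mem_univ x) (Set.mem_univ y) hp hq hpq
  refine (h₁.add h₂).congr fun x _ => ?_
  rw [← Finset.add_sum_erase _ _ (Finset.mem_univ i), ← add_assoc,
    abs_proj_sub_add _ (point_eq_zero_or_one c i)]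
  rfl

theorem convexOn_objective {n : ℕ} [Nonempty (Fin n)] (c : Fin n → Bool) :
    ConvexOn ℝ Set.univ (objective c) := by
  refine ⟨convex_univ, fun x _ y _ p q hp hq hpq => ?_⟩
  obtain ⟨i, hi⟩ := exists_objective_eq c (p • x + q • y)
  rw [hi]
  refine ((convexOn_abs_proj_sub_add_sum c i).2 (Set.mem_univ x) (Set.mem_univ y)
    hp hq hpq).trans ?_
  exact add_le_add (mul_le_mul_of_nonneg_left (le_objective c x i) hp)
    (mul_le_mul_of_nonneg_left (le_objective c y i) hq)

theorem objective_point {n : ℕ} (c : Fin n → Bool) : objective c (point c) = 0 := by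
  simp [objective, proj_point]

theorem objective_nonneg {n : ℕ} (c : Fin n → Bool) (x : Fin n → ℝ) : 0 ≤ objective c x :=
  add_nonneg (Real.iSup_nonneg fun _ => abs_nonneg _) (Finset.sum_nonneg fun _ _ => abs_nonneg _)

theorem abs_proj_sub_point_le_objective {n : ℕ} (c : Fin n → Bool) (x : Fin n → ℝ) (i : Fin n) :
    |proj (x i) - point c i| ≤ objective c x :=
  (le_add_of_nonneg_right (Finset.sum_nonneg fun _ _ => abs_nonneg _)).trans (le_objective c x i)

theorem eq_point_of_objective_le_zero {n : ℕ} {c : Fin n → Bool} {x : Fin n → ℝ}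
    (h : objective c x ≤ 0) : x = point c := by
  funext i
  have h₁ := (le_objective c x i).trans h
  have h₂ := Finset.single_le_sum (f := fun j => |proj (x j) - x j|)
    (fun _ _ => abs_nonneg _) (Finset.mem_univ i)
  have h₃ := abs_proj_sub_add (x i) (point_eq_zero_or_one c i)
  exact sub_eq_zero.mp (abs_nonpos_iff.mp (by linarith))

theorem isMin_objective_iff {n : ℕ} (c : Fin n → Bool) (y : Fin n → ℝ) :
    (∀ x, objective c y ≤ objective c x) ↔ y = point c := by
  constructor
  · intro h
    exact eq_point_of_objective_le_zero ((h (point c)).trans_eq (objective_point c))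
  · rintro rfl x
    rw [objective_point]
    exact objective_nonneg c x

theorem point_mem_unitCube {n : ℕ} (c : Fin n → Bool) : point c ∈ unitCube n := by
  intro i
  rcases point_eq_zero_or_one c i with h | h <;> simp [h]

/-- At an index where the strings differ, a common point would project within `1/3` of both 0 and 1.
-/
theorem disjoint_approxMin {n : ℕ} {c d : Fin n → Bool} (hcd : c ≠ d) {K : Set (Fin n → ℝ)}
    (hK : ∀ c : Fin n → Bool, point c ∈ K) :
    Disjoint (approxMin (objective c) K (1 / 3)) (approxMin (objective d) K (1 / 3)) := by
  rw [Set.disjoint_left]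
  rintro x ⟨-, hc⟩ ⟨-, hd⟩
  obtain ⟨i, hi⟩ := Function.ne_iff.mp hcd
  have h₁ := hc _ (hK c)
  have h₂ := hd _ (hK d)
  rw [objective_point] at h₁ h₂
  have h₃ := abs_le.mp ((abs_proj_sub_point_le_objective c x i).trans h₁)
  have h₄ := abs_le.mp ((abs_proj_sub_point_le_objective d x i).trans h₂)
  unfold point at h₃ h₄
  cases hci : c i <;> cases hdi : d i <;> simp_all <;> linarith

/-! ### Flipping one bit -/

/-- The bit string `c` with its `i`-th bit flipped. -/
def flipBit {n : ℕ} (i : Fin n) (c : Fin n → Bool) : Fin n → Bool := Function.update c i (!c i)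

theorem flipBit_involutive {n : ℕ} (i : Fin n) : Function.Involutive (flipBit i) := by
  intro c
  simp [flipBit]

theorem ne_flipBit {n : ℕ} (i : Fin n) (c : Fin n → Bool) : c ≠ flipBit i c := by
  intro h
  have := congrFun h i
  simp [flipBit] at this

/-- At any query point, at most one bit flip lowers the objective. -/
theorem eq_of_objective_flipBit_lt {n : ℕ} {c : Fin n → Bool} {x : Fin n → ℝ} {i j : Fin n}
    (hi : objective (flipBit i c) x < objective c x)
    (hj : objective (flipBit j c) x < objective c x) : i = j := by
  have : Nonempty (Fin n) := ⟨i⟩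
  obtain ⟨k, hk⟩ := exists_objective_eq c x
  -- Flipping a bit other than the maximizing `k` leaves the `k`-th term, hence the old value, as a
  -- lower bound.
  have key : ∀ l, objective (flipBit l c) x < objective c x → k = l := by
    intro l hl
    by_contra hkl
    have h := le_objective (flipBit l c) x k
    have hp : point (flipBit l c) k = point c k := by simp [point, flipBit, hkl]
    rw [hp, ← hk] at h
    exact absurd h (not_le.mpr hl)
  exact (key i hi).symm.trans (key j hj)

/-- The adversary weight `s⁻¹` on rising and `s` on falling values. -/
def weight (s a b : ℝ) : ℝ := if a < b then s⁻¹ else if b < a then s else 0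

theorem weight_nonneg {s : ℝ} (hs : 0 < s) (a b : ℝ) : 0 ≤ weight s a b := by
  unfold weight
  split_ifs <;> positivity

theorem weight_le {s : ℝ} (hs : 0 < s) (a b : ℝ) : weight s a b ≤ s⁻¹ + s := by
  have := inv_pos.mpr hs
  unfold weight
  split_ifs <;> linarith

theorem weight_mul_weight {s : ℝ} (hs : 0 < s) {a b : ℝ} (h : a ≠ b) :
    weight s a b * weight s b a = 1 := by
  unfold weight
  rcases lt_or_gt_of_ne h with h | h
  · simp [h, h.not_gt, hs.ne']
  · simp [h, h.not_gt, hs.ne']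

/-- The choice `s = √n` balances up to `n` rising flips of weight `1/√n` against a single falling
flip of weight `√n`. -/
theorem sum_weight_flipBit_le {n : ℕ} (hn : 0 < n) (c : Fin n → Bool) (x : Fin n → ℝ) :
    ∑ i, weight (√n) (objective c x) (objective (flipBit i c) x) ≤ 2 * √n := by
  classical
  have hs : 0 < √(n : ℝ) := Real.sqrt_pos.mpr (by exact_mod_cast hn)
  set p : Fin n → Prop := fun i => objective (flipBit i c) x < objective c x
  have h₁ : ∀ i, weight (√n) (objective c x) (objective (flipBit i c) x)
      ≤ (√n)⁻¹ + if p i then √n else 0 := by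
    intro i
    have := inv_pos.mpr hs
    simp only [weight, p]
    split_ifs <;> linarith
  have h₂ : (Finset.univ.filter p).card ≤ 1 := by
    rw [Finset.card_le_one]
    intro i hi j hj
    exact eq_of_objective_flipBit_lt (Finset.mem_filter.mp hi).2 (Finset.mem_filter.mp hj).2
  have h₃ : ((Finset.univ.filter p).card : ℝ) ≤ 1 := by exact_mod_cast h₂
  have h₄ : (n : ℝ) * (√n)⁻¹ = √n := by
    rw [← div_eq_mul_inv, Real.div_sqrt]
  calc _ ≤ ∑ i, ((√n)⁻¹ + if p i then √(n : ℝ) else 0) := Finset.sum_le_sum fun i _ => h₁ i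
    _ = √n + (Finset.univ.filter p).card * √n := by
      rw [Finset.sum_add_distrib, ← Finset.sum_filter, Finset.sum_const, Finset.sum_const]
      simp [h₄]
    _ ≤ 2 * √n := by nlinarith

/-! ### Square-summable states and the oracle -/

theorem hasSum_norm_sq {ι : Type v} (ψ : ℓ²(ι, ℂ)) :
    HasSum (fun b => ‖ψ b‖ ^ 2) (‖ψ‖ ^ 2) := by
  have h := lp.hasSum_norm (p := 2) (by norm_num) ψ
  simpa using h

theorem mul_le_of_one_le_mul {u v : ℝ} (hu : 0 ≤ u) (huv : 1 ≤ u * v) (a b : ℝ) :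
    a * b ≤ (u * a ^ 2 + v * b ^ 2) / 2 := by
  have h₁ : 0 < u := lt_of_le_of_ne hu (by rintro rfl; linarith [zero_mul v])
  have h₂ : v * b ^ 2 ≥ u⁻¹ * b ^ 2 := by
    refine mul_le_mul_of_nonneg_right ?_ (sq_nonneg b)
    rw [inv_le_iff_one_le_mul₀ h₁]; linarith
  have h₃ : 0 ≤ u⁻¹ * (u * a - b) ^ 2 := by positivity
  have h₄ : u⁻¹ * (u * a - b) ^ 2 = u * a ^ 2 - 2 * (a * b) + u⁻¹ * b ^ 2 := by
    field_simp
    ring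
  linarith

theorem summable_weight_mul_norm_sq {ι : Type v} {w : ι → ℝ} {B : ℝ} (hw : ∀ b, 0 ≤ w b)
    (hB : ∀ b, w b ≤ B) (ψ : ℓ²(ι, ℂ)) : Summable fun b => w b * ‖ψ b‖ ^ 2 :=
  Summable.of_nonneg_of_le (fun b => mul_nonneg (hw b) (sq_nonneg _))
    (fun b => mul_le_mul_of_nonneg_right (hB b) (sq_nonneg _))
    ((hasSum_norm_sq ψ).summable.mul_left B)

/-- Reduces inverse queries to ordinary ones. -/
theorem evalOracle_symm {n : ℕ} (f : (Fin n → ℝ) → ℝ) (W : Type v) (ψ : State n W) :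
    (evalOracle f W).symm ψ = evalOracle (fun x => -f x) W ψ := by
  rw [LinearIsometryEquiv.symm_apply_eq]
  ext b
  change ψ b = ψ (b.1, b.2.1 - f b.1 - -f b.1, b.2.2)
  simp

/-- One oracle call changes the inner product of two states only through the query points on
which the two oracles differ. -/
theorem norm_inner_evalOracle_sub_le {n : ℕ} {W : Type v} {f g : (Fin n → ℝ) → ℝ}
    {u w : (Fin n → ℝ) → ℝ} {B : ℝ} (hu : ∀ x, 0 ≤ u x) (hw : ∀ x, 0 ≤ w x)
    (huB : ∀ x, u x ≤ B) (hwB : ∀ x, w x ≤ B) (huw : ∀ x, f x ≠ g x → 1 ≤ u x * w x)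
    (φ ψ : State n W) :
    ‖⟪evalOracle f W φ, evalOracle g W ψ⟫_ℂ - ⟪φ, ψ⟫_ℂ‖ ≤
      (∑' b : Label n W, u b.1 * ‖φ b‖ ^ 2) + ∑' b : Label n W, w b.1 * ‖ψ b‖ ^ 2 := by
  -- Reindexing by the first shift leaves `φ` untouched and moves only `ψ`, by `σ`, which fixes the
  -- query point.
  set σ : Label n W ≃ Label n W := (answerShift f W).trans (answerShift g W).symm with hσ
  have h₁ : HasSum (fun b => ⟪φ b, ψ (σ b)⟫_ℂ) ⟪evalOracle f W φ, evalOracle g W ψ⟫_ℂ := by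
    have h := lp.hasSum_inner (𝕜 := ℂ) (evalOracle f W φ) (evalOracle g W ψ)
    rw [← Equiv.hasSum_iff (answerShift f W)] at h
    refine h.congr_fun fun b => ?_
    change ⟪φ b, ψ (σ b)⟫_ℂ = ⟪φ ((answerShift f W).symm (answerShift f W b)), ψ (σ b)⟫_ℂ
    rw [Equiv.symm_apply_apply]
  have h₂ := h₁.sub (lp.hasSum_inner (𝕜 := ℂ) φ ψ)
  have hU := (summable_weight_mul_norm_sq (w := fun b : Label n W => u b.1)
    (fun b => hu b.1) (fun b => huB b.1) φ).hasSum
  have hV := (summable_weight_mul_norm_sq (w := fun b : Label n W => w b.1)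
    (fun b => hw b.1) (fun b => hwB b.1) ψ).hasSum
  -- Weighted AM-GM charges half of the `w`-weight to `ψ b` and half to `ψ (σ b)`; both halves have
  -- the same total.
  have hV' := (Equiv.hasSum_iff σ).mpr hV
  have hM := hU.add ((hV.add hV').div_const 2)
  rw [add_self_div_two] at hM
  rw [← h₂.tsum_eq]
  refine tsum_of_norm_bounded hM fun b => ?_
  simp only [Function.comp]
  have hσ₁ : (σ b).1 = b.1 := rfl
  rw [hσ₁]
  have hu' := hu b.1
  have hw' := hw b.1
  by_cases hb : f b.1 = g b.1
  · have hσ₂ : σ b = b := by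
      change (b.1, b.2.1 + f b.1 - g b.1, b.2.2) = b
      rw [hb, add_sub_cancel_right]
    rw [hσ₂, sub_self, norm_zero]
    positivity
  · have h₃ := mul_le_of_one_le_mul hu' (huw _ hb) ‖φ b‖ ‖ψ b‖
    have h₄ := mul_le_of_one_le_mul hu' (huw _ hb) ‖φ b‖ ‖ψ (σ b)‖
    have h₅ := norm_sub_le ⟪φ b, ψ (σ b)⟫_ℂ ⟪φ b, ψ b⟫_ℂ
    have h₆ := norm_inner_le_norm (𝕜 := ℂ) (φ b) (ψ b)
    have h₇ := norm_inner_le_norm (𝕜 := ℂ) (φ b) (ψ (σ b))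
    linarith

/-- Two unit vectors that are told apart with probability `9/10` are far from parallel. -/
theorem norm_inner_le_of_disjoint {ι : Type v} {S T : Set ι} (hST : Disjoint S T)
    {φ ψ : ℓ²(ι, ℂ)} (hφ : ‖φ‖ = 1) (hψ : ‖ψ‖ = 1)
    (hS : 9 / 10 ≤ ∑' b : S, ‖φ b‖ ^ 2) (hT : 9 / 10 ≤ ∑' b : T, ‖ψ b‖ ^ 2) :
    ‖⟪φ, ψ⟫_ℂ‖ ≤ 3 / 5 := by
  classical
  have hp := hasSum_norm_sq φ
  have hq := hasSum_norm_sq ψ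
  rw [hφ, one_pow] at hp
  rw [hψ, one_pow] at hq
  have hpS := (hp.summable.indicator S).hasSum
  have hqT := (hq.summable.indicator T).hasSum
  rw [tsum_subtype S fun b => ‖φ b‖ ^ 2] at hS
  rw [tsum_subtype T fun b => ‖ψ b‖ ^ 2] at hT
  -- AM-GM with weights `1/3` on the likely set and `3` off it (`3 - 8/3 = 1/3`); the total is at
  -- most `3 - (8/3) * (9/10) = 3/5`.
  have hM := ((((hp.mul_left 3).sub (hpS.mul_left (8 / 3))).add
    ((hq.mul_left 3).sub (hqT.mul_left (8 / 3))))).div_const 2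
  rw [← (lp.hasSum_inner (𝕜 := ℂ) φ ψ).tsum_eq]
  refine (tsum_of_norm_bounded hM fun b => ?_).trans (by linarith)
  refine (norm_inner_le_norm (𝕜 := ℂ) (φ b) (ψ b)).trans ?_
  have ha := norm_nonneg (φ b)
  have hb := norm_nonneg (ψ b)
  by_cases h₁ : b ∈ S
  · have h₂ : b ∉ T := Set.disjoint_left.mp hST h₁
    simp only [Set.indicator, h₁, h₂, if_true, if_false]
    nlinarith [sq_nonneg (‖φ b‖ - 3 * ‖ψ b‖)]
  · by_cases h₂ : b ∈ T
    · simp only [Set.indicator, h₁, h₂, if_true, if_false]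
      nlinarith [sq_nonneg (3 * ‖φ b‖ - ‖ψ b‖)]
    · simp only [Set.indicator, h₁, h₂, if_false]
      nlinarith [sq_nonneg (‖φ b‖ - ‖ψ b‖)]

/-! ### The adversary bound -/

namespace QueryAlgorithm

variable {n : ℕ} {W : Type v} (A : QueryAlgorithm n W)

theorem norm_stateAfter (f : (Fin n → ℝ) → ℝ) (t : ℕ) : ‖A.stateAfter f t‖ = 1 := by
  induction t with
  | zero => simp [stateAfter, A.norm_init]
  | succ t ih =>
    simp only [stateAfter, LinearIsometryEquiv.norm_map]
    split_ifs <;> simp [ih]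

theorem norm_inner_stateAfter_succ_sub_le {f g u w : (Fin n → ℝ) → ℝ} {B : ℝ}
    (hu : ∀ x, 0 ≤ u x) (hw : ∀ x, 0 ≤ w x) (huB : ∀ x, u x ≤ B) (hwB : ∀ x, w x ≤ B)
    (huw : ∀ x, f x ≠ g x → 1 ≤ u x * w x) (t : ℕ) :
    ‖⟪A.stateAfter f (t + 1), A.stateAfter g (t + 1)⟫_ℂ
        - ⟪A.stateAfter f t, A.stateAfter g t⟫_ℂ‖ ≤
      (∑' b : Label n W, u b.1 * ‖A.stateAfter f t b‖ ^ 2)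
        + ∑' b : Label n W, w b.1 * ‖A.stateAfter g t b‖ ^ 2 := by
  simp only [stateAfter, LinearIsometryEquiv.inner_map_map]
  cases A.inverse t
  · simpa using norm_inner_evalOracle_sub_le hu hw huB hwB huw (A.stateAfter f t)
      (A.stateAfter g t)
  · simp only [if_true, evalOracle_symm]
    exact norm_inner_evalOracle_sub_le hu hw huB hwB
      (fun x hx => huw x fun h => hx (by rw [h])) _ _

/-- The progress measure: the sum of the inner products of the states for neighbouring strings. -/
def progress (t : ℕ) : ℂ :=
  ∑ c : Fin n → Bool, ∑ i,
    ⟪A.stateAfter (objective c) t, A.stateAfter (objective (flipBit i c)) t⟫_ℂ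

theorem progress_zero : A.progress 0 = 2 ^ n * n := by
  have h : ∀ f, A.stateAfter f 0 = A.gate 0 A.init := fun _ => rfl
  simp [progress, h, inner_self_eq_norm_sq_to_K, A.norm_init]

theorem norm_progress_succ_sub_le (hn : 0 < n) (t : ℕ) :
    ‖A.progress (t + 1) - A.progress t‖ ≤ 2 ^ n * (4 * √n) := by
  have hs : 0 < √(n : ℝ) := Real.sqrt_pos.mpr (by exact_mod_cast hn)
  set ψ : (Fin n → Bool) → State n W := fun c => A.stateAfter (objective c) t with hψ
  set F : (Fin n → Bool) → Fin n → ℝ := fun c i => ∑' b : Label n W,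
    weight (√n) (objective c b.1) (objective (flipBit i c) b.1) * ‖ψ c b‖ ^ 2 with hF
  have h₁ : ∀ c i, ‖⟪A.stateAfter (objective c) (t + 1),
        A.stateAfter (objective (flipBit i c)) (t + 1)⟫_ℂ
      - ⟪A.stateAfter (objective c) t, A.stateAfter (objective (flipBit i c)) t⟫_ℂ‖
      ≤ F c i + F (flipBit i c) i := by
    intro c i
    have h := A.norm_inner_stateAfter_succ_sub_le (f := objective c)
      (g := objective (flipBit i c))
      (u := fun x => weight (√n) (objective c x) (objective (flipBit i c) x))
      (w := fun x => weight (√n) (objective (flipBit i c) x) (objective c x))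
      (fun x => weight_nonneg hs _ _) (fun x => weight_nonneg hs _ _)
      (fun x => weight_le hs _ _) (fun x => weight_le hs _ _)
      (fun x hx => (weight_mul_weight hs hx).ge) t
    simpa only [hF, flipBit_involutive i c] using h
  have h₂ : ∀ c, ∑ i, F c i ≤ 2 * √n := by
    intro c
    have hsum : ∀ i, Summable fun b : Label n W =>
        weight (√n) (objective c b.1) (objective (flipBit i c) b.1) * ‖ψ c b‖ ^ 2 := fun i =>
      summable_weight_mul_norm_sq (fun b => weight_nonneg hs _ _) (fun b => weight_le hs _ _) (ψ c)
    have hone := hasSum_norm_sq (ψ c)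
    rw [hψ, A.norm_stateAfter, one_pow] at hone
    have hle := hasSum_le (fun b => ?_) (hasSum_sum fun i (_ : i ∈ Finset.univ) => (hsum i).hasSum)
      (hone.mul_left (2 * √n))
    · simpa using hle
    · rw [← Finset.sum_mul]
      exact mul_le_mul_of_nonneg_right (sum_weight_flipBit_le hn c b.1) (sq_nonneg _)
  -- For fixed `i`, flipping permutes the strings, so both ends of the pairs contribute equally.
  have h₃ : ∑ c, ∑ i, F (flipBit i c) i = ∑ c, ∑ i, F c i := by
    rw [Finset.sum_comm, Finset.sum_comm (f := fun c i => F c i)]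
    exact Finset.sum_congr rfl fun i _ =>
      Equiv.sum_comp (flipBit_involutive i).toPerm fun c => F c i
  have h₄ : ∑ c, ∑ i, F c i ≤ 2 ^ n * (2 * √n) :=
    (Finset.sum_le_sum fun c _ => h₂ c).trans_eq (by simp)
  simp only [progress, ← Finset.sum_sub_distrib]
  calc _ ≤ ∑ c, ∑ i, (F c i + F (flipBit i c) i) :=
        (norm_sum_le _ _).trans (Finset.sum_le_sum fun c _ =>
          (norm_sum_le _ _).trans (Finset.sum_le_sum fun i _ => h₁ c i))
    _ = 2 * ∑ c, ∑ i, F c i := by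
      simp only [Finset.sum_add_distrib]
      rw [h₃]; ring
    _ ≤ 2 ^ n * (4 * √n) := by linarith

theorem norm_progress_sub_le (hn : 0 < n) (t : ℕ) :
    ‖A.progress t - A.progress 0‖ ≤ t * (2 ^ n * (4 * √n)) := by
  induction t with
  | zero => simp
  | succ t ih =>
    have h := norm_sub_le_norm_sub_add_norm_sub (A.progress (t + 1)) (A.progress t) (A.progress 0)
    have h' := A.norm_progress_succ_sub_le hn t
    push_cast
    linarith

theorem norm_progress_queries_le {K : Set (Fin n → ℝ)} (hK : ∀ c : Fin n → Bool, point c ∈ K)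
    (hA : A.SolvesMaxNorm K) : ‖A.progress A.queries‖ ≤ 2 ^ n * (n * (3 / 5)) := by
  have h : ∀ c i, ‖⟪A.stateAfter (objective c) A.queries,
      A.stateAfter (objective (flipBit i c)) A.queries⟫_ℂ‖ ≤ 3 / 5 := fun c i =>
    norm_inner_le_of_disjoint
      ((disjoint_approxMin (ne_flipBit i c) hK).preimage A.output)
      (A.norm_stateAfter _ _) (A.norm_stateAfter _ _) (hA c) (hA (flipBit i c))
  refine (norm_sum_le _ _).trans ((Finset.sum_le_sum fun c _ =>
    (norm_sum_le _ _).trans (Finset.sum_le_sum fun i _ => h c i)).trans_eq ?_)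
  simp

theorem sqrt_le_queries (hn : 0 < n) {K : Set (Fin n → ℝ)}
    (hK : ∀ c : Fin n → Bool, point c ∈ K) (hA : A.SolvesMaxNorm K) :
    √n / 10 ≤ A.queries := by
  have hs : 0 < √(n : ℝ) := Real.sqrt_pos.mpr (by exact_mod_cast hn)
  have hsq : √(n : ℝ) * √n = n := Real.mul_self_sqrt (Nat.cast_nonneg n)
  have h₁ := A.norm_progress_sub_le hn A.queries
  have h₂ := A.norm_progress_queries_le hK hA
  have h₃ := norm_sub_norm_le (A.progress 0) (A.progress A.queries)
  rw [norm_sub_rev] at h₃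
  have h₄ : ‖A.progress 0‖ = 2 ^ n * n := by simp [progress_zero]
  have h₅ : (2 : ℝ) ^ n * √n * (√n / 10) ≤ 2 ^ n * √n * A.queries := by
    have h₆ : (2 : ℝ) ^ n * √n * (√n / 10) = 2 ^ n * n / 10 := by linear_combination 2 ^ n / 10 * hsq
    rw [h₆]
    linarith
  exact le_of_mul_le_mul_left h₅ (by positivity)

end QueryAlgorithm

end

end MaxNormOpt

theorem mainTheorem4 :
    (∀ n : ℕ, 1 ≤ n → ∀ c : Fin n → Bool,
      ConvexOn ℝ Set.univ (MaxNormOpt.objective c) ∧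
      ∀ y : Fin n → ℝ,
        (∀ x : Fin n → ℝ, MaxNormOpt.objective c y ≤ MaxNormOpt.objective c x) ↔
          y = MaxNormOpt.point c) ∧
    (∃ C : ℝ, 0 < C ∧
      ∀ n : ℕ, 2 ≤ n → ∀ (W : Type*) (A : MaxNormOpt.QueryAlgorithm n W),
        (A.SolvesMaxNorm (MaxNormOpt.unitCube n) ∨ A.SolvesMaxNorm Set.univ) →
          C * (Real.sqrt n / Real.log n) ≤ (A.queries : ℝ)) := by
  -- Since `log 2 ≤ log n`, this constant makes the claim follow from the stronger bound `√n / 10`.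
  refine ⟨fun n hn c => ?_, Real.log 2 / 10, by positivity, fun n hn W A hA => ?_⟩
  · have : Nonempty (Fin n) := ⟨⟨0, hn⟩⟩
    exact ⟨MaxNormOpt.convexOn_objective c, MaxNormOpt.isMin_objective_iff c⟩
  · have h₁ : Real.sqrt n / 10 ≤ (A.queries : ℝ) := by
      rcases hA with hA | hA
      · exact A.sqrt_le_queries (by omega) MaxNormOpt.point_mem_unitCube hA
      · exact A.sqrt_le_queries (by omega) (fun _ => Set.mem_univ _) hA
    refine le_trans ?_ h₁
    have h₂ : 0 < Real.log 2 := Real.log_pos (by norm_num)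
    have h₃ : Real.log 2 ≤ Real.log n := Real.log_le_log (by norm_num) (by exact_mod_cast hn)
    rw [← mul_div_assoc, div_le_iff₀ (h₂.trans_le h₃)]
    nlinarith [mul_le_mul_of_nonneg_left h₃ (Real.sqrt_nonneg n)]
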